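/- Let $R=K[x_1,\dots,x_n]$ be a standard graded polynomial ring over a field $K$. For a graded ideal $J\subsetneq R$ write the Hilbert series of $R/J$ as $$\sum_{k\ge 0}\dim_K (R/J)_k\,t^k=\frac{Q_{R/J}(t)}{(1-t)^{\dim R/J}}$$ with $Q_{R/J}\in\mathbb Z[t]$, and let $\operatorname{mult}(R/J)=Q_{R/J}(1)$ be the multiplicity of $R/J$ (if $\dim R/J=d+1>0$ this is $d!$ times the coefficient of $t^d$ in the Hilbert polynomial of $R/J$; if $\dim R/J=0$ it is the length of $R/J$). Let $I$ be a monomial ideal of $R$, $I\neq R$, of height $h$, and let $$I=Q_1\cap\dots\cap Q_r\cap Q_{r+1}\cap\dots\cap Q_t$$ be a primary decomposition that is reduced (the radicals $\sqrt{Q_i}$ are pairwise distinct) and irredundant ($Q_i\not\supseteq\bigcap_{j\ne i}Q_j$ for every $i$), where $\operatorname{height}(Q_i)=h$ for $1\le i\le r$ and $\operatorname{height}(Q_i)>h$ for $r<i\le t$. Then the following hold. (1) For every integer $s\ge 1$, $$\operatorname{mult}(R/I^s)=\sum_{i=1}^r\operatorname{mult}(R/Q_i^s).$$ (2) Suppose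 that each $Q_i$ with $1\le i\le r$ is an irreducible monomial ideal, that is, $Q_i$ is generated by powers of $h$ distinct variables, with positive exponents $a_{i_1},\dots,a_{i_h}$. Then for every integer $s\ge 1$, $$\operatorname{mult}(R/I^s)=\operatorname{mult}(R/I)\binom{h+s-1}{s-1}=\sum_{i=1}^r\Big(\prod_{j=1}^h a_{i_j}\Big)\binom{h+s-1}{s-1}.$$ -/

import Mathlib

namespace MonomialMult

/-- An ideal of `K[x_1, …, x_n]` is monomial if it is generated by a set of monomials. -/
def IsMonomialIdeal {K : Type*} [Field K] {n : ℕ} (I : Ideal (MvPolynomial (Fin n) K)) : Prop :=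
  ∃ S : Set (Fin n →₀ ℕ), I = Ideal.span ((fun m => MvPolynomial.monomial m (1 : K)) '' S)

/-- `I = ⋂ Q_i` is a primary decomposition which is reduced (the radicals of the `Q_i` are
pairwise distinct) and irredundant (no `Q_i` contains the intersection of the others). -/
structure IsIrredundantReducedPrimaryDecomposition {R : Type*} [CommRing R] {t : ℕ}
    (I : Ideal R) (Q : Fin t → Ideal R) : Prop where
  eq_iInf : I = ⨅ i, Q i
  primary : ∀ i, (Q i).IsPrimary
  reduced : ∀ i j, i ≠ j → (Q i).radical ≠ (Q j).radical
  irredundant : ∀ i, ¬ (⨅ j : Fin t, ⨅ _ : j ≠ i, Q j) ≤ Q i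

/-- The Hilbert function of `R/J`, `R = K[x_1, …, x_n]`: the `K`-dimension of the degree `k`
component of `R/J`, that is, of the image in `R/J` of the forms of degree `k`. -/
noncomputable def hilbertFunction {K : Type*} [Field K] {n : ℕ}
    (J : Ideal (MvPolynomial (Fin n) K)) (k : ℕ) : ℕ :=
  Module.finrank K
    ((MvPolynomial.homogeneousSubmodule (Fin n) K k).map (Ideal.Quotient.mkₐ K J).toLinearMap)

/-- The Hilbert series of `R/J`. -/
noncomputable def hilbertSeries {K : Type*} [Field K] {n : ℕ}
    (J : Ideal (MvPolynomial (Fin n) K)) : PowerSeries ℤ :=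
  PowerSeries.mk fun k => (hilbertFunction J k : ℤ)

/-- The Krull dimension of `R/J`, as a natural number (`0` when `J = R`). -/
noncomputable def quotDim {K : Type*} [Field K] {n : ℕ}
    (J : Ideal (MvPolynomial (Fin n) K)) : ℕ :=
  ((ringKrullDim (MvPolynomial (Fin n) K ⧸ J)).unbotD 0).toNat

open Classical in
/-- The multiplicity `mult(R/J)`: write the Hilbert series of `R/J` as `Q(t) / (1 - t) ^ dim (R/J)`
with a polynomial `Q` (unique; it exists for every graded ideal `J`); the multiplicity is `Q(1)`.
For `dim (R/J) = d + 1 > 0` this is `d !` times the coefficient of `t ^ d` in the Hilbert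
polynomial, and for `dim (R/J) = 0` it is the length of `R/J`. -/
noncomputable def mult {K : Type*} [Field K] {n : ℕ}
    (J : Ideal (MvPolynomial (Fin n) K)) : ℤ :=
  if h : ∃ Q : Polynomial ℤ,
      hilbertSeries J * (1 - PowerSeries.X) ^ quotDim J = (Q : PowerSeries ℤ) then
    h.choose.eval 1
  else 0

end MonomialMult

/-! Multiplicity is turned into a finite count. For a monomial ideal J and large M, membership of a
monomial depends only on its exponents cut off at M. Grouping the monomials outside J by their
truncation c gives a finite sum of terms t^deg c / (1 - t)^(number of entries of c equal to M).
Every c outside J satisfies J ≤ (x_i : c_i < M), so at least h = height J entries lie below M;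
clearing (1 - t)^(n - h) and setting t = 1 leaves the number of c with exactly h such entries
(`mult_eq_card`).

For additivity, a c counted for I^s gives a prime P = (x_i : c_i < M) of height h containing I,
hence P is the radical of some Q_i with i ≤ r. A monomial u outside P carries Q_i into I, so u^s
carries Q_i^s into I^s; multiplying by u^s only raises capped entries, so c is also counted for
Q_i^s. Distinct radicals make these counts disjoint (`mult_pow_eq_sum`).

For irreducible Q_i, a monomial lies in Q_i^s exactly when ∑ ⌊m_j / a_j⌋ ≥ s. Division with
remainder then identifies the counted exponents with ∏ a_j remainders times the quotient vectors of
sum less than s. -/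

namespace MonomialMult

open MvPolynomial

/-! ### Monomial ideals and their Hilbert functions -/

section Monomial

variable {K : Type*} [Field K] {n : ℕ}

/-- The exponents of the monomials that lie in `J`. -/
def exps (J : Ideal (MvPolynomial (Fin n) K)) : Set (Fin n →₀ ℕ) :=
  {m | monomial m (1 : K) ∈ J}

theorem monomial_mem_of_mem_exps {J : Ideal (MvPolynomial (Fin n) K)} {m : Fin n →₀ ℕ}
    (hm : m ∈ exps J) (a : K) : monomial m a ∈ J := by
  have h := J.mul_mem_left (C a) hm
  rwa [C_mul_monomial, mul_one] at h

theorem exps_mono {I J : Ideal (MvPolynomial (Fin n) K)} (h : I ≤ J) : exps I ⊆ exps J :=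
  fun _ hm => h hm

theorem add_mem_exps_mul {I J : Ideal (MvPolynomial (Fin n) K)} {m m' : Fin n →₀ ℕ}
    (hm : m ∈ exps I) (hm' : m' ∈ exps J) : m + m' ∈ exps (I * J) := by
  have h := Ideal.mul_mem_mul hm hm'
  rwa [monomial_mul, one_mul] at h

theorem add_mem_exps {J : Ideal (MvPolynomial (Fin n) K)} {m : Fin n →₀ ℕ}
    (u : Fin n →₀ ℕ) (hm : m ∈ exps J) : u + m ∈ exps J := by
  have h := J.mul_mem_left (monomial u 1) hm
  rwa [monomial_mul, one_mul] at h

theorem mem_exps_of_le {J : Ideal (MvPolynomial (Fin n) K)} {m m' : Fin n →₀ ℕ}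
    (h : m ≤ m') (hm : m ∈ exps J) : m' ∈ exps J := by
  have := add_mem_exps (m' - m) hm
  rwa [tsub_add_cancel_of_le h] at this

theorem mem_of_support_subset_exps {J : Ideal (MvPolynomial (Fin n) K)}
    {f : MvPolynomial (Fin n) K} (hf : ∀ m ∈ f.support, m ∈ exps J) : f ∈ J := by
  rw [f.as_sum]
  exact J.sum_mem fun m hm => monomial_mem_of_mem_exps (hf m hm) _

theorem support_monomial_one (m : Fin n →₀ ℕ) : (monomial m (1 : K)).support = {m} := by
  classical
  rw [support_monomial, if_neg one_ne_zero]

theorem mem_exps_span {S : Set (Fin n →₀ ℕ)} {m : Fin n →₀ ℕ} :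
    m ∈ exps (Ideal.span ((fun m => monomial m (1 : K)) '' S)) ↔ ∃ a ∈ S, a ≤ m := by
  rw [exps, Set.mem_ofPred_eq, mem_ideal_span_monomial_image]
  simp [support_monomial_one]

theorem IsMonomialIdeal.mem_exps_of_mem {J : Ideal (MvPolynomial (Fin n) K)}
    (hJ : IsMonomialIdeal J) {f : MvPolynomial (Fin n) K} (hf : f ∈ J) {m : Fin n →₀ ℕ}
    (hm : m ∈ f.support) : m ∈ exps J := by
  obtain ⟨S, rfl⟩ := hJ
  exact mem_exps_span.2 (mem_ideal_span_monomial_image.1 hf m hm)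

theorem IsMonomialIdeal.mul {I J : Ideal (MvPolynomial (Fin n) K)}
    (hI : IsMonomialIdeal I) (hJ : IsMonomialIdeal J) : IsMonomialIdeal (I * J) := by
  obtain ⟨S, rfl⟩ := hI
  obtain ⟨T, rfl⟩ := hJ
  refine ⟨Set.image2 (· + ·) S T, ?_⟩
  rw [Ideal.span_mul_span', ← Set.image2_mul, Set.image2_image_left, Set.image2_image_right,
    Set.image_image2]
  simp only [monomial_mul, one_mul]

theorem IsMonomialIdeal.pow {J : Ideal (MvPolynomial (Fin n) K)}
    (hJ : IsMonomialIdeal J) (s : ℕ) : IsMonomialIdeal (J ^ s) := by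
  induction s with
  | zero =>
    refine ⟨{0}, ?_⟩
    simp
  | succ s ih =>
    rw [pow_succ]
    exact ih.mul hJ

/-- Every polynomial is the sum of its terms with a given property and of those without. -/
theorem exists_split (p : (Fin n →₀ ℕ) → Prop) (f : MvPolynomial (Fin n) K) :
    ∃ f₁ f₂, f = f₁ + f₂ ∧ (∀ m ∈ f₁.support, p m) ∧ (∀ m ∈ f₂.support, ¬ p m) := by
  classical
  have key : ∀ (T : Finset (Fin n →₀ ℕ)) (m : Fin n →₀ ℕ),
      m ∈ (∑ m ∈ T, monomial m (f.coeff m)).support → m ∈ T := by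
    intro T m hm
    rw [mem_support_iff, coeff_sum] at hm
    simp only [coeff_monomial, Finset.sum_ite_eq', ne_eq, ite_eq_right_iff, Classical.not_imp] at hm
    exact hm.1
  refine ⟨∑ m ∈ f.support.filter p, monomial m (f.coeff m),
    ∑ m ∈ f.support.filter (¬ p ·), monomial m (f.coeff m), ?_, ?_, ?_⟩
  · conv_lhs => rw [f.as_sum]
    exact (Finset.sum_filter_add_sum_filter_not _ _ _).symm
  · exact fun m hm => (Finset.mem_filter.1 (key _ m hm)).2
  · exact fun m hm => (Finset.mem_filter.1 (key _ m hm)).2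

/-- The monomials outside `J` give a basis of the graded piece: the others vanish in the quotient,
and a relation would be an element of `J` all of whose monomials must lie in `J`. -/
theorem hilbertFunction_eq_card {J : Ideal (MvPolynomial (Fin n) K)} (hJ : IsMonomialIdeal J)
    [DecidablePred (· ∈ exps J)] (k : ℕ) :
    hilbertFunction J k =
      ((Finset.univ.finsuppAntidiag k : Finset (Fin n →₀ ℕ)).filter (· ∉ exps J)).card := by
  classical
  set A := (Finset.univ.finsuppAntidiag k : Finset (Fin n →₀ ℕ)).filter (· ∉ exps J) with hA
  let π := (Ideal.Quotient.mkₐ K J).toLinearMap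
  let v : A → MvPolynomial (Fin n) K ⧸ J := fun m => π (monomial m.1 1)
  have hdeg : ∀ m : Fin n →₀ ℕ, m ∈ (Finset.univ.finsuppAntidiag k : Finset (Fin n →₀ ℕ)) ↔
      m.degree = k := by
    intro m
    simp [Finset.mem_finsuppAntidiag, Finsupp.degree_eq_sum]
  have hspan : (homogeneousSubmodule (Fin n) K k).map π = Submodule.span K (Set.range v) := by
    apply le_antisymm
    · rintro _ ⟨f, hf, rfl⟩
      rw [f.as_sum, map_sum]
      refine Submodule.sum_mem _ fun m hm => ?_
      by_cases hmJ : m ∈ exps J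
      · have : π (monomial m (f.coeff m)) = 0 :=
          Ideal.Quotient.eq_zero_iff_mem.2 (monomial_mem_of_mem_exps hmJ _)
        rw [this]
        exact Submodule.zero_mem _
      · have hmA : m ∈ A := by
          rw [hA, Finset.mem_filter, hdeg]
          refine ⟨?_, hmJ⟩
          have := hf (mem_support_iff.1 hm)
          rw [Finsupp.degree_eq_weight_one]
          exact this
        have : monomial m (f.coeff m) = f.coeff m • monomial m (1 : K) := by
          rw [smul_monomial, smul_eq_mul, mul_one]
        rw [this, map_smul]
        exact Submodule.smul_mem _ _ (Submodule.subset_span ⟨⟨m, hmA⟩, rfl⟩)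
    · rw [Submodule.span_le]
      rintro _ ⟨⟨m, hm⟩, rfl⟩
      refine ⟨monomial m 1, ?_, rfl⟩
      rw [hA, Finset.mem_filter, hdeg] at hm
      exact isHomogeneous_monomial _ hm.1
  have hli : LinearIndependent K v := by
    rw [Fintype.linearIndependent_iff]
    intro g hg i
    have hmem : ∑ m : A, monomial m.1 (g m) ∈ J := by
      rw [← Ideal.Quotient.eq_zero_iff_mem, ← hg, map_sum]
      refine Finset.sum_congr rfl fun m _ => ?_
      have : monomial m.1 (g m) = g m • monomial m.1 (1 : K) := by
        rw [smul_monomial, smul_eq_mul, mul_one]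
      rw [this]
      exact map_smul π _ _
    by_contra hgi
    have hco : (∑ m : A, monomial m.1 (g m)).coeff i.1 = g i := by
      rw [coeff_sum, Finset.sum_eq_single i]
      · simp
      · intro b _ hb
        rw [coeff_monomial, if_neg]
        exact fun h => hb (Subtype.ext h)
      · simp
    have := hJ.mem_exps_of_mem hmem (m := i.1) (by rw [mem_support_iff, hco]; exact hgi)
    exact (Finset.mem_filter.1 i.2).2 this
  change Module.finrank K ((homogeneousSubmodule (Fin n) K k).map π) = _
  rw [hspan, finrank_span_eq_card hli, Fintype.card_coe]

end Monomial

/-! ### Truncated exponents and the Hilbert series -/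

section Truncation

variable {K : Type*} [Field K] {n : ℕ}

/-- The exponent with all entries equal to `M`. -/
noncomputable def cap (n M : ℕ) : Fin n →₀ ℕ := Finsupp.equivFunOnFinite.symm fun _ => M

@[simp] theorem cap_apply (M : ℕ) (i : Fin n) : cap n M i = M := rfl

/-- Membership of a monomial in `J` depends only on its exponents cut off at `M`. -/
def IsTruncation (J : Ideal (MvPolynomial (Fin n) K)) (M : ℕ) : Prop :=
  ∀ m, m ⊓ cap n M ∈ exps J ↔ m ∈ exps J

/-- By Noetherianity finitely many monomials generate `J`; once `M` bounds their exponents,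
truncation does not affect divisibility by them. The eventual form lets several ideals share one
`M`. -/
theorem eventually_isTruncation {J : Ideal (MvPolynomial (Fin n) K)} (hJ : IsMonomialIdeal J) :
    ∀ᶠ M in Filter.atTop, IsTruncation J M := by
  classical
  obtain ⟨S, rfl⟩ := hJ
  obtain ⟨T, hTS, hT⟩ :=
    (Submodule.fg_span_iff_fg_span_finset_subset _).1 (IsNoetherian.noetherian
      (Ideal.span ((fun m => monomial m (1 : K)) '' S)))
  obtain ⟨U, hUS, rfl⟩ := Finset.subset_set_image_iff.1 hTS
  have hU : Ideal.span ((fun m => monomial m (1 : K)) '' S) =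
      Ideal.span ((fun m => monomial m (1 : K)) '' (U : Set (Fin n →₀ ℕ))) := by
    rw [Ideal.span, hT, Finset.coe_image, Ideal.span]
  rw [hU]
  filter_upwards [Filter.eventually_ge_atTop (∑ u ∈ U, u.degree)] with M hM m
  refine ⟨mem_exps_of_le inf_le_left, fun hm => ?_⟩
  obtain ⟨u, hu, hum⟩ := mem_exps_span.1 hm
  refine mem_exps_span.2 ⟨u, hu, le_inf hum fun i => ?_⟩
  calc u i ≤ u.degree := Finsupp.le_degree i u
    _ ≤ ∑ u ∈ U, u.degree := Finset.single_le_sum (f := fun u => u.degree) (by simp) hu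
    _ ≤ M := hM

/-- The indices at which the exponent `c` stays below `M`. -/
def low (M : ℕ) (c : Fin n →₀ ℕ) : Finset (Fin n) := Finset.univ.filter fun i => c i < M

@[simp] theorem mem_low {M : ℕ} {c : Fin n →₀ ℕ} {i : Fin n} : i ∈ low M c ↔ c i < M := by
  simp [low]

/-- Multiplying by variables whose exponents already sit at the cap is invisible after truncation.
-/
theorem add_inf_cap_eq {M : ℕ} {c u : Fin n →₀ ℕ} (hc : c ≤ cap n M)
    (hu : ∀ i ∈ low M c, u i = 0) : (u + c) ⊓ cap n M = c := by
  ext i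
  have hi : c i ≤ M := hc i
  by_cases h : c i < M
  · simp [hu i (mem_low.2 h), hi]
  · simp only [Finsupp.inf_apply, Finsupp.add_apply, cap_apply]
    omega

/-- The generating function of the exponents of one variable which are cut off at `M` to `a`. -/
noncomputable def truncSeries (M a : ℕ) : PowerSeries ℤ :=
  PowerSeries.mk fun b => if min b M = a then 1 else 0

theorem truncSeries_of_lt {M a : ℕ} (h : a < M) : truncSeries M a = PowerSeries.X ^ a := by
  ext b
  rw [truncSeries, PowerSeries.coeff_mk, PowerSeries.coeff_X_pow]
  congr 1
  rw [eq_iff_iff]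
  omega

theorem truncSeries_self (M : ℕ) :
    truncSeries M M * (1 - PowerSeries.X) = PowerSeries.X ^ M := by
  ext b
  rw [mul_sub, mul_one, map_sub, PowerSeries.coeff_X_pow]
  cases b with
  | zero =>
    rw [PowerSeries.coeff_zero_mul_X, truncSeries, PowerSeries.coeff_mk, sub_zero]
    congr 1
  | succ b =>
    rw [PowerSeries.coeff_succ_mul_X, truncSeries, PowerSeries.coeff_mk, PowerSeries.coeff_mk]
    split_ifs <;> omega

/-- An entry below `M` contributes a single power of t, an entry equal to `M` the geometric series
t^M / (1 - t). -/
theorem prod_truncSeries_mul {M : ℕ} {c : Fin n →₀ ℕ} (hc : c ≤ cap n M) :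
    (∏ i, truncSeries M (c i)) * (1 - PowerSeries.X) ^ (n - (low M c).card) =
      PowerSeries.X ^ c.degree := by
  have hcard : n - (low M c).card = (Finset.univ.filter fun i => ¬ c i < M).card := by
    have := Finset.card_filter_add_card_filter_not (s := (Finset.univ : Finset (Fin n)))
      (fun i => c i < M)
    rw [Finset.card_univ, Fintype.card_fin] at this
    rw [low]
    omega
  rw [hcard, ← Finset.prod_const, Finset.prod_filter, ← Finset.prod_mul_distrib,
    Finsupp.degree_eq_sum, ← Finset.prod_pow_eq_pow_sum]
  refine Finset.prod_congr rfl fun i _ => ?_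
  have hi : c i ≤ M := hc i
  split_ifs with h
  · rw [mul_one, truncSeries_of_lt h]
  · rw [le_antisymm hi (not_lt.1 h), truncSeries_self]

-- A truncation class lies wholly inside or wholly outside `J`, and its generating function factors
-- over the variables.
open Classical in
theorem hilbertSeries_eq_sum {J : Ideal (MvPolynomial (Fin n) K)} (hJ : IsMonomialIdeal J)
    {M : ℕ} (hM : IsTruncation J M) :
    hilbertSeries J =
      ∑ c ∈ (Finset.Iic (cap n M)).filter (· ∉ exps J), ∏ i, truncSeries M (c i) := by
  ext k
  rw [hilbertSeries, PowerSeries.coeff_mk, hilbertFunction_eq_card hJ, map_sum]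
  simp only [PowerSeries.coeff_prod, truncSeries, PowerSeries.coeff_mk]
  rw [Finset.sum_comm, Finset.card_filter, Nat.cast_sum]
  refine Finset.sum_congr rfl fun m _ => ?_
  have hprod : ∀ c : Fin n →₀ ℕ, (∏ i, if min (m i) M = c i then (1 : ℤ) else 0) =
      if m ⊓ cap n M = c then 1 else 0 := by
    intro c
    rw [Finset.prod_ite_zero]
    simp [Finsupp.ext_iff]
  simp only [hprod]
  rw [Finset.sum_ite_eq]
  simp only [Finset.mem_filter, Finset.mem_Iic, inf_le_right, true_and, hM m]
  split_ifs <;> simp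

open Classical in
/-- The numerator of the Hilbert series of a monomial ideal. -/
theorem mult_eq_card_of_quotDim {J : Ideal (MvPolynomial (Fin n) K)} (hJ : IsMonomialIdeal J)
    {M : ℕ} (hM : IsTruncation J M) {h : ℕ} (hd : quotDim J + h = n)
    (hlow : ∀ c ≤ cap n M, c ∉ exps J → h ≤ (low M c).card) :
    mult J = ((Finset.Iic (cap n M)).filter
      fun c => c ∉ exps J ∧ (low M c).card = h).card := by
  -- `hlow` makes the subtraction in the exponent genuine, so this is the numerator; at 1 only the
  -- terms with exponent 0 survive.
  set P : Polynomial ℤ := ∑ c ∈ (Finset.Iic (cap n M)).filter (· ∉ exps J),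
    Polynomial.X ^ c.degree * (1 - Polynomial.X) ^ ((low M c).card - h) with hP
  have hPs : hilbertSeries J * (1 - PowerSeries.X) ^ quotDim J = (P : PowerSeries ℤ) := by
    rw [hilbertSeries_eq_sum hJ hM, Finset.sum_mul, hP,
      ← Polynomial.coeToPowerSeries.ringHom_apply, map_sum]
    refine Finset.sum_congr rfl fun c hc => ?_
    rw [Finset.mem_filter, Finset.mem_Iic] at hc
    have h1 := hlow c hc.1 hc.2
    have h2 : (low M c).card ≤ n := by simpa using Finset.card_le_univ (low M c)
    have h3 : quotDim J = (n - (low M c).card) + ((low M c).card - h) := by omega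
    rw [h3, pow_add, ← mul_assoc, prod_truncSeries_mul hc.1]
    simp
  have hex : ∃ Q : Polynomial ℤ,
      hilbertSeries J * (1 - PowerSeries.X) ^ quotDim J = (Q : PowerSeries ℤ) := ⟨P, hPs⟩
  have hch : hex.choose = P := by
    exact Polynomial.coe_injective ℤ (hex.choose_spec.symm.trans hPs)
  rw [mult, dif_pos hex, hch, hP, Polynomial.eval_finsetSum, ← Finset.filter_filter,
    Finset.card_filter (fun c => (low M c).card = h), Nat.cast_sum]
  refine Finset.sum_congr rfl fun c hc => ?_
  rw [Finset.mem_filter, Finset.mem_Iic] at hc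
  have h1 := hlow c hc.1 hc.2
  simp only [Polynomial.eval_mul, Polynomial.eval_pow, Polynomial.eval_X, one_pow, one_mul,
    Polynomial.eval_sub, Polynomial.eval_one, sub_self]
  split_ifs with h4
  · simp [h4]
  · rw [zero_pow (by omega)]
    rfl

end Truncation

/-! ### Primes generated by variables, heights and dimension -/

section VarIdeal

variable {K : Type*} [Field K] {n : ℕ}

/-- The ideal generated by the variables with index in `F`. -/
noncomputable def varIdeal (K : Type*) [Field K] {n : ℕ} (F : Finset (Fin n)) : Ideal (MvPolynomial (Fin n) K) :=
  Ideal.span (X '' (F : Set (Fin n)))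

theorem mem_varIdeal {F : Finset (Fin n)} {f : MvPolynomial (Fin n) K} :
    f ∈ varIdeal K F ↔ ∀ m ∈ f.support, ∃ i ∈ F, m i ≠ 0 :=
  mem_ideal_span_X_image

theorem mem_exps_varIdeal {F : Finset (Fin n)} {m : Fin n →₀ ℕ} :
    m ∈ exps (varIdeal K F) ↔ ∃ i ∈ F, m i ≠ 0 := by
  rw [exps, Set.mem_ofPred_eq, mem_varIdeal, support_monomial_one]
  simp

theorem X_mem_varIdeal {F : Finset (Fin n)} {i : Fin n} :
    (X i : MvPolynomial (Fin n) K) ∈ varIdeal K F ↔ i ∈ F := by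
  rw [mem_varIdeal, support_X]
  simp [Finsupp.single_apply]

theorem varIdeal_le_iff {F : Finset (Fin n)} {J : Ideal (MvPolynomial (Fin n) K)} :
    varIdeal K F ≤ J ↔ ∀ i ∈ F, X i ∈ J := by
  rw [varIdeal, Ideal.span_le, Set.image_subset_iff]
  rfl

theorem varIdeal_le_varIdeal {F G : Finset (Fin n)} :
    varIdeal K F ≤ varIdeal K G ↔ F ⊆ G := by
  rw [varIdeal_le_iff]
  simp only [X_mem_varIdeal]
  rfl

theorem exists_mem_support_of_not_mem_varIdeal {F : Finset (Fin n)} {f : MvPolynomial (Fin n) K}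
    (hf : f ∉ varIdeal K F) : ∃ m ∈ f.support, ∀ i ∈ F, m i = 0 := by
  rw [mem_varIdeal] at hf
  push Not at hf
  exact hf

instance varIdeal_isPrime (F : Finset (Fin n)) : (varIdeal K F).IsPrime := by
  classical
  -- Setting the variables of `F` to zero maps into a domain, and its kernel is the ideal in
  -- question.
  let φ : MvPolynomial (Fin n) K →ₐ[K] MvPolynomial (Fin n) K :=
    aeval fun i => if i ∈ F then 0 else X i
  have h1 : ∀ f, f - φ f ∈ varIdeal K F := by
    intro f
    induction f using MvPolynomial.induction_on with
    | C a => simp [φ]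
    | add p q hp hq =>
      rw [map_add, add_sub_add_comm]
      exact Ideal.add_mem _ hp hq
    | mul_X p i hp =>
      have hX : X i - φ (X i) ∈ varIdeal K F := by
        by_cases hi : i ∈ F
        · simpa [φ, hi] using X_mem_varIdeal.2 hi
        · simp [φ, hi]
      have : p * X i - φ (p * X i) = (p - φ p) * X i + φ p * (X i - φ (X i)) := by
        rw [map_mul]
        ring
      rw [this]
      exact Ideal.add_mem _ (Ideal.mul_mem_right _ _ hp) (Ideal.mul_mem_left _ _ hX)
  have h2 : varIdeal K F = RingHom.ker φ := by
    apply le_antisymm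
    · rw [varIdeal_le_iff]
      intro i hi
      simp [RingHom.mem_ker, φ, hi]
    · intro f hf
      have := h1 f
      rwa [RingHom.mem_ker.1 hf, sub_zero] at this
  rw [h2]
  exact RingHom.ker_isPrime _

/-- Krull's height theorem bounds the height above; adjoining one variable at a time gives a chain
of primes that bounds it below. -/
theorem height_varIdeal (F : Finset (Fin n)) : (varIdeal K F).height = F.card := by
  classical
  apply le_antisymm
  · have hF : varIdeal K F ∈ (Ideal.span ((F.image X : Finset (MvPolynomial (Fin n) K)) :
        Set (MvPolynomial (Fin n) K))).minimalPrimes := by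
      rw [Finset.coe_image]
      change varIdeal K F ∈ (varIdeal K F).minimalPrimes
      rw [Ideal.minimalPrimes_eq_subsingleton_self]
      rfl
    refine (Ideal.height_le_card_of_mem_minimalPrimes_span_finset hF).trans ?_
    exact_mod_cast Finset.card_image_le
  · induction F using Finset.induction_on with
    | empty => simp
    | insert i F hi ih =>
      rw [Finset.card_insert_of_notMem hi]
      have hlt : varIdeal K F < varIdeal K (insert i F) :=
        lt_of_le_not_ge (varIdeal_le_varIdeal.2 (Finset.subset_insert i F)) fun h =>
          hi (varIdeal_le_varIdeal.1 h (Finset.mem_insert_self i F))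
      have := Ideal.height_add_one_le_of_lt_of_isPrime hlt
      push_cast
      exact (add_le_add_left ih 1).trans this

/-- Take the variables in `p`: each monomial of `J` lies in `p`, so one of its variables does. -/
theorem IsMonomialIdeal.exists_varIdeal_le {J p : Ideal (MvPolynomial (Fin n) K)}
    (hJ : IsMonomialIdeal J) [hp : p.IsPrime] (hJp : J ≤ p) :
    ∃ F : Finset (Fin n), J ≤ varIdeal K F ∧ varIdeal K F ≤ p := by
  classical
  refine ⟨Finset.univ.filter fun i => X i ∈ p, ?_, ?_⟩
  · intro f hf
    rw [mem_varIdeal]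
    intro m hm
    have hmp := hJp (hJ.mem_exps_of_mem hf hm)
    rw [monomial_eq, C_1, one_mul, Finsupp.prod, hp.prod_mem_iff] at hmp
    obtain ⟨i, hi, hip⟩ := hmp
    exact ⟨i, by simpa using hp.mem_of_pow_mem _ hip, Finsupp.mem_support_iff.1 hi⟩
  · rw [varIdeal_le_iff]
    intro i hi
    simpa using hi

/-- A monomial of `J` free of the low variables could be multiplied onto `c` without changing its
truncation, forcing `c` into `exps J`. -/
theorem le_varIdeal_low {J : Ideal (MvPolynomial (Fin n) K)} (hJ : IsMonomialIdeal J) {M : ℕ}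
    (hM : IsTruncation J M) {c : Fin n →₀ ℕ} (hc : c ≤ cap n M) (hcJ : c ∉ exps J) :
    J ≤ varIdeal K (low M c) := by
  intro f hf
  by_contra hcon
  obtain ⟨m, hm, hm0⟩ := exists_mem_support_of_not_mem_varIdeal hcon
  have hmc := add_mem_exps c (hJ.mem_exps_of_mem hf hm)
  rw [← hM, add_comm, add_inf_cap_eq hc hm0] at hmc
  exact hcJ hmc

theorem ringKrullDim_mvPolynomial_field (ι : Type*) [Finite ι] :
    ringKrullDim (MvPolynomial ι K) = Nat.card ι := by
  rw [MvPolynomial.ringKrullDim_of_isNoetherianRing, ringKrullDim_eq_zero_of_field, zero_add]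

theorem length_add_height_le {R : Type*} [CommRing R] (l : LTSeries (PrimeSpectrum R)) (i : ℕ)
    (hi : i ≤ l.length) :
    l.head.asIdeal.height + i ≤ (l ⟨i, Nat.lt_succ_of_le hi⟩).asIdeal.height := by
  induction i with
  | zero => simp [RelSeries.head]
  | succ i ih =>
    have h1 := ih (by omega)
    have hlt : (l ⟨i, by omega⟩).asIdeal < (l ⟨i + 1, by omega⟩).asIdeal :=
      l.strictMono (by simp [Fin.lt_def])
    have h2 := Ideal.height_add_one_le_of_lt_of_isPrime hlt
    push_cast
    rw [← add_assoc]
    exact (add_le_add_left h1 1).trans h2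

/-- A chain of primes over `J` starts at height at least `h` and ends at height at most `n`.
Conversely a prime of variables of height `h` contains `J`, so `R/J` maps onto a polynomial ring in
`n - h` variables. -/
theorem ringKrullDim_quotient_eq {J : Ideal (MvPolynomial (Fin n) K)} (hJ : IsMonomialIdeal J)
    {h : ℕ} (hh : J.height = h) :
    h ≤ n ∧ ringKrullDim (MvPolynomial (Fin n) K ⧸ J) = ((n - h : ℕ) : WithBot ℕ∞) := by
  classical
  obtain ⟨p, hp, hJp, hph⟩ := Ideal.exists_isPrime_height_eq hh
  obtain ⟨F, hJF, hFp⟩ := hJ.exists_varIdeal_le hJp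
  have hF : F.card = h := by
    have h1 := Ideal.height_mono hJF
    have h2 := Ideal.height_mono hFp
    rw [height_varIdeal, hh] at h1
    rw [height_varIdeal, hph] at h2
    exact le_antisymm (by exact_mod_cast h2) (by exact_mod_cast h1)
  have hhn : h ≤ n := by
    rw [← hF]
    simpa using Finset.card_le_univ F
  refine ⟨hhn, le_antisymm ?_ ?_⟩
  · rw [ringKrullDim_quotient, Order.krullDim]
    refine iSup_le fun l => ?_
    let l' : LTSeries (PrimeSpectrum (MvPolynomial (Fin n) K)) := l.map Subtype.val fun _ _ => id
    have h1 := length_add_height_le l' l'.length le_rfl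
    have h2 : (h : ℕ∞) ≤ l'.head.asIdeal.height := by
      rw [← hh]
      exact Ideal.height_mono l.head.2
    have h3 := (l' ⟨l'.length, Nat.lt_succ_self _⟩).asIdeal.height_le_ringKrullDim_of_isPrime
    rw [ringKrullDim_mvPolynomial_field, Nat.card_fin] at h3
    have h4 : (l' ⟨l'.length, Nat.lt_succ_self _⟩).asIdeal.height ≤ n := by exact_mod_cast h3
    have h5 : ((h + l'.length : ℕ) : ℕ∞) ≤ n := by
      push_cast
      exact (add_le_add_left h2 _).trans (h1.trans h4)
    have h6 : h + l'.length ≤ n := by exact_mod_cast h5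
    have h7 : l.length ≤ n - h := by
      change l'.length ≤ n - h
      omega
    exact_mod_cast h7
  · let e : {i : Fin n // i ∉ F} → Fin n := Subtype.val
    have he : Function.Injective e := Subtype.val_injective
    let φ : MvPolynomial (Fin n) K →ₐ[K] MvPolynomial {i : Fin n // i ∉ F} K := killCompl he
    have hφ : Function.Surjective φ := fun f => ⟨rename e f, killCompl_rename_app he f⟩
    have hJφ : ∀ f ∈ J, φ f = 0 := by
      intro f hf
      have : varIdeal K F ≤ RingHom.ker φ := by
        rw [varIdeal_le_iff]
        intro i hi
        rw [RingHom.mem_ker]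
        simp only [φ, killCompl, aeval_X]
        rw [dif_neg]
        rintro ⟨j, rfl⟩
        exact j.2 hi
      exact this (hJF hf)
    have hdim := ringKrullDim_le_of_surjective (Ideal.Quotient.lift J φ.toRingHom hJφ)
      (Ideal.Quotient.lift_surjective_of_surjective _ _ hφ)
    rw [ringKrullDim_mvPolynomial_field, Nat.card_eq_fintype_card, Fintype.card_subtype_compl,
      Fintype.card_fin, Fintype.card_coe, hF] at hdim
    exact hdim

theorem quotDim_add_height {J : Ideal (MvPolynomial (Fin n) K)} (hJ : IsMonomialIdeal J)
    {h : ℕ} (hh : J.height = h) : quotDim J + h = n := by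
  obtain ⟨hhn, hd⟩ := ringKrullDim_quotient_eq hJ hh
  have : quotDim J = n - h := by
    rw [quotDim, hd]
    rfl
  omega

open Classical in
/-- The multiplicity of a monomial ideal of height `h` counts the truncated exponents outside of
the ideal of which exactly `h` entries are below the truncation bound. -/
theorem mult_eq_card {J : Ideal (MvPolynomial (Fin n) K)} (hJ : IsMonomialIdeal J)
    {M : ℕ} (hM : IsTruncation J M) {h : ℕ} (hh : J.height = h) :
    mult J = ((Finset.Iic (cap n M)).filter
      fun c => c ∉ exps J ∧ (low M c).card = h).card := by
  refine mult_eq_card_of_quotDim hJ hM (quotDim_add_height hJ hh) fun c hc hcJ => ?_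
  have := Ideal.height_mono (le_varIdeal_low hJ hM hc hcJ)
  rw [hh, height_varIdeal] at this
  exact_mod_cast this

theorem height_radical {R : Type*} [CommRing R] (J : Ideal R) : J.radical.height = J.height := by
  rw [Ideal.height_eq_inf_minimalPrimes, Ideal.radical_minimalPrimes,
    ← Ideal.height_eq_inf_minimalPrimes]

theorem height_pow {R : Type*} [CommRing R] (J : Ideal R) {s : ℕ} (hs : 1 ≤ s) :
    (J ^ s).height = J.height := by
  rw [← height_radical, Ideal.radical_pow J (by omega), height_radical]

end VarIdeal

/-! ### Isolated primary components of monomial ideals -/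

section PrimaryComponent

variable {K : Type*} [Field K] {n : ℕ}

/-- A monomial not involving the variables of the prime `varIdeal F` can be cancelled modulo a
primary ideal with that radical. -/
theorem mem_exps_of_add_mem_exps {q : Ideal (MvPolynomial (Fin n) K)} (hq : q.IsPrimary)
    {F : Finset (Fin n)} (hF : q.radical = varIdeal K F) {u m : Fin n →₀ ℕ}
    (hu : ∀ i ∈ F, u i = 0) (hum : u + m ∈ exps q) : m ∈ exps q := by
  have h : monomial m (1 : K) * monomial u 1 ∈ q := by
    rw [monomial_mul, one_mul, add_comm]
    exact hum
  refine ((Ideal.isPrimary_iff.1 hq).2 h).resolve_right fun hr => ?_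
  rw [hF] at hr
  obtain ⟨i, hi, hne⟩ := mem_exps_varIdeal.1 hr
  exact hne (hu i hi)

/-- If a power of `w` kills `f` modulo `J` and so does `u + w`, then so does a power of `u`. -/
theorem exists_pow_mul_mem {R : Type*} [CommRing R] {J : Ideal R} {u w f : R}
    (hw : w ∈ J.radical) (h : (u + w) * f ∈ J) : ∃ N, u ^ N * f ∈ J := by
  obtain ⟨N, hN⟩ := hw
  refine ⟨N, ?_⟩
  obtain ⟨d, hd⟩ := sub_dvd_pow_sub_pow u (-w) N
  have : u ^ N * f = d * ((u + w) * f) + (-1) ^ N * f * w ^ N := by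
    rw [sub_eq_iff_eq_add] at hd
    rw [hd, neg_pow w N]
    ring
  rw [this]
  exact J.add_mem (J.mul_mem_left _ h) (J.mul_mem_left _ hN)

variable {I q : Ideal (MvPolynomial (Fin n) K)} {F : Finset (Fin n)}

theorem exists_add_mem_exps (hI : IsMonomialIdeal I) {g : MvPolynomial (Fin n) K}
    (hg : g ∉ varIdeal K F) (hgq : ∀ f ∈ q, g * f ∈ I) {m : Fin n →₀ ℕ} (hm : m ∈ exps q) :
    ∃ u : Fin n →₀ ℕ, (∀ i ∈ F, u i = 0) ∧ u + m ∈ exps I := by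
  obtain ⟨u, hu, hu0⟩ := exists_mem_support_of_not_mem_varIdeal hg
  refine ⟨u, hu0, hI.mem_exps_of_mem (hgq _ hm) ?_⟩
  rw [mem_support_iff, coeff_mul_monomial, mul_one]
  exact mem_support_iff.1 hu

/-- A primary component of a monomial ideal at a minimal prime is a monomial ideal. -/
theorem isMonomialIdeal_of_isolated (hI : IsMonomialIdeal I) (hq : q.IsPrimary) (hIq : I ≤ q)
    (hF : q.radical = varIdeal K F) {g : MvPolynomial (Fin n) K}
    (hg : g ∉ varIdeal K F) (hgq : ∀ f ∈ q, g * f ∈ I) : IsMonomialIdeal q := by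
  set q' : Ideal (MvPolynomial (Fin n) K) := Ideal.span ((fun m => monomial m (1 : K)) '' exps q)
    with hq'
  have hmon : IsMonomialIdeal q' := ⟨_, rfl⟩
  have hq'q : q' ≤ q := by
    rw [hq', Ideal.span_le]
    rintro _ ⟨m, hm, rfl⟩
    exact hm
  have hqq' : exps q ⊆ exps q' := fun m hm => mem_exps_span.2 ⟨m, hm, le_rfl⟩
  refine ⟨exps q, le_antisymm (fun f hf => ?_) hq'q⟩
  change f ∈ q'
  have hIq' : I ≤ q' := fun x hx => mem_of_support_subset_exps fun m hm =>
    hqq' (exps_mono hIq (hI.mem_exps_of_mem hx hm))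
  have hrad : varIdeal K F ≤ q'.radical := by
    rw [varIdeal_le_iff]
    intro i hi
    have hX : (X i : MvPolynomial (Fin n) K) ∈ q.radical := by
      rw [hF]
      exact X_mem_varIdeal.2 hi
    obtain ⟨N, hN⟩ := hX
    rw [X_pow_eq_monomial] at hN
    refine ⟨N, ?_⟩
    rw [X_pow_eq_monomial]
    exact hqq' hN
  -- Split `g` into the part `u` free of the variables of `F` and a part `w` nilpotent modulo `q'`;
  -- split `f` likewise into terms in `q` and terms outside. It remains to show that the second part
  -- `f₂` of `f` is zero.
  obtain ⟨u, w, rfl, hu, hw⟩ := exists_split (fun m => ∀ i ∈ F, m i = 0) g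
  have hwF : w ∈ varIdeal K F := mem_varIdeal.2 fun m hm => by
    have := hw m hm
    push Not at this
    exact this
  have hu0 : u ≠ 0 := by
    rintro rfl
    rw [zero_add] at hg
    exact hg hwF
  obtain ⟨f₁, f₂, rfl, hf₁, hf₂⟩ := exists_split (fun m => m ∈ exps q) f
  have hf₁q : f₁ ∈ q' := mem_of_support_subset_exps fun m hm => hqq' (hf₁ m hm)
  refine q'.add_mem hf₁q ?_
  have hgf₂ : (u + w) * f₂ ∈ q' := by
    have := q'.sub_mem (hIq' (hgq _ hf)) (q'.mul_mem_left (u + w) hf₁q)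
    rwa [← mul_sub, add_sub_cancel_left] at this
  obtain ⟨N, hN⟩ := exists_pow_mul_mem (hrad hwF) hgf₂
  by_cases hf0 : f₂ = 0
  · rw [hf0]
    exact q'.zero_mem
  exfalso
  -- The leading exponent of `u ^ N * f₂` is that of `u ^ N` plus that of `f₂`. It lies in `exps q`,
  -- and the first summand avoids `F`, so it cancels: the leading monomial of `f₂` lies in `q`,
  -- against its choice.
  let o : MonomialOrder (Fin n) := MonomialOrder.lex
  have hne : u ^ N * f₂ ≠ 0 := mul_ne_zero (pow_ne_zero _ hu0) hf0
  have hdeg := hmon.mem_exps_of_mem hN (o.degree_mem_support hne)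
  rw [o.degree_mul (pow_ne_zero _ hu0) hf0, o.degree_pow] at hdeg
  refine hf₂ _ (o.degree_mem_support hf0)
    (mem_exps_of_add_mem_exps hq hF (fun i hi => ?_) (exps_mono hq'q hdeg))
  rw [Finsupp.smul_apply, hu _ (o.degree_mem_support hu0) i hi, smul_zero]

/-- A single monomial prime to `varIdeal F` multiplies the component at `varIdeal F` into `I`. -/
theorem exists_monomial_mul_mem (hI : IsMonomialIdeal I) (hqm : IsMonomialIdeal q)
    {g : MvPolynomial (Fin n) K} (hg : g ∉ varIdeal K F) (hgq : ∀ f ∈ q, g * f ∈ I) :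
    ∃ u : Fin n →₀ ℕ, (∀ i ∈ F, u i = 0) ∧ Ideal.span {monomial u (1 : K)} * q ≤ I := by
  classical
  obtain ⟨T, hT⟩ := IsNoetherian.noetherian q
  have key : ∀ T : Finset (MvPolynomial (Fin n) K), (∀ f ∈ T, f ∈ q) →
      ∃ u : Fin n →₀ ℕ, (∀ i ∈ F, u i = 0) ∧ ∀ f ∈ T, ∀ m ∈ f.support, u + m ∈ exps I := by
    intro T hTq
    have h1 : ∀ m : Fin n →₀ ℕ, ∃ u : Fin n →₀ ℕ, (∀ i ∈ F, u i = 0) ∧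
        (m ∈ exps q → u + m ∈ exps I) := by
      intro m
      by_cases hm : m ∈ exps q
      · obtain ⟨u, hu, hum⟩ := exists_add_mem_exps hI hg hgq hm
        exact ⟨u, hu, fun _ => hum⟩
      · exact ⟨0, by simp, fun h => absurd h hm⟩
    choose u hu0 hu using h1
    -- The sum dominates each individual multiplier, so it works for all the monomials at once.
    refine ⟨∑ m ∈ T.biUnion support, u m, fun i hi => ?_, fun f hf m hm => ?_⟩
    · rw [Finsupp.finsetSum_apply]
      exact Finset.sum_eq_zero fun m _ => hu0 m i hi
    · refine mem_exps_of_le (add_le_add_left ?_ m) (hu m (hqm.mem_exps_of_mem (hTq f hf) hm))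
      exact Finset.single_le_sum (f := u) (fun _ _ => bot_le) (Finset.mem_biUnion.2 ⟨f, hf, hm⟩)
  obtain ⟨u, hu0, hu⟩ := key T fun f hf => hT ▸ Submodule.subset_span hf
  refine ⟨u, hu0, ?_⟩
  rw [← hT]
  change Ideal.span _ * Ideal.span _ ≤ I
  rw [Ideal.span_mul_span', Ideal.span_le]
  rintro _ ⟨x, hx, f, hf, rfl⟩
  rw [Set.mem_singleton_iff.1 hx]
  change monomial u 1 * f ∈ I
  rw [f.as_sum, Finset.mul_sum]
  refine I.sum_mem fun m hm => ?_
  rw [monomial_mul, one_mul]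
  exact monomial_mem_of_mem_exps (hu f hf m hm) _

/-- The prime of variables squeezed between `I` and `p` also has height `h`, and nested primes of
equal finite height coincide. -/
theorem exists_eq_varIdeal_of_height {p : Ideal (MvPolynomial (Fin n) K)} [p.IsPrime]
    (hI : IsMonomialIdeal I) (hIp : I ≤ p) {h : ℕ} (hh : I.height = h) (hp : p.height = h) :
    ∃ F : Finset (Fin n), F.card = h ∧ p = varIdeal K F := by
  obtain ⟨F, hIF, hFp⟩ := hI.exists_varIdeal_le hIp
  have h1 := Ideal.height_mono hIF
  have h2 : varIdeal K F = p := Ideal.eq_of_le_of_height_le _ hFp (by rw [hp, ← hh]; exact h1)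
  refine ⟨F, ?_, h2.symm⟩
  have h3 := height_varIdeal (K := K) F
  rw [h2, hp] at h3
  exact_mod_cast h3.symm

end PrimaryComponent

/-! ### Separating a component of minimal height from the others -/

section Decomposition

variable {R : Type*} [CommRing R] {t : ℕ} {I : Ideal R} {Q : Fin t → Ideal R}

theorem IsIrredundantReducedPrimaryDecomposition.le
    (hQ : IsIrredundantReducedPrimaryDecomposition I Q) (i : Fin t) : I ≤ Q i :=
  hQ.eq_iInf.le.trans (iInf_le _ i)

theorem IsIrredundantReducedPrimaryDecomposition.exists_le_of_le_isPrime
    (hQ : IsIrredundantReducedPrimaryDecomposition I Q) {p : Ideal R} (hp : p.IsPrime)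
    (hIp : I ≤ p) : ∃ i, Q i ≤ p := by
  rw [hQ.eq_iInf, ← Finset.inf_univ_eq_iInf, hp.inf_le'] at hIp
  obtain ⟨i, -, hi⟩ := hIp
  exact ⟨i, hi⟩

/-- Outside the other components, a component of minimal height is carried into the ideal. -/
theorem IsIrredundantReducedPrimaryDecomposition.exists_not_mem_radical_mul_mem
    (hQ : IsIrredundantReducedPrimaryDecomposition I Q) {h : ℕ} (hh : I.height = h) {i : Fin t}
    (hi : (Q i).height = h) :
    ∃ g ∉ (Q i).radical, ∀ f ∈ Q i, g * f ∈ I := by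
  classical
  have hp : (Q i).radical.IsPrime := Ideal.isPrime_radical (hQ.primary i)
  have h1 : ∀ j, ∃ g, j ≠ i → g ∈ Q j ∧ g ∉ (Q i).radical := by
    intro j
    by_cases hji : j = i
    · exact ⟨0, fun h => absurd hji h⟩
    -- Otherwise the radicals would be nested primes; as that of `Q j` has height at least `h`, they
    -- would be equal.
    have hle : ¬ Q j ≤ (Q i).radical := by
      intro hle
      have hpj : (Q j).radical.IsPrime := Ideal.isPrime_radical (hQ.primary j)
      have hle' : (Q j).radical ≤ (Q i).radical := hp.isRadical.radical_le_iff.2 hle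
      have h2 : (h : ℕ∞) ≤ (Q j).radical.height := by
        rw [← hh, height_radical]
        exact Ideal.height_mono (hQ.le j)
      have h3 : (Q i).radical.height = h := by rw [height_radical, hi]
      have : (Q j).radical.FiniteHeight := by
        rw [Ideal.finiteHeight_iff]
        right
        have := Ideal.height_mono hle'
        rw [h3] at this
        exact ne_top_of_le_ne_top (ENat.natCast_ne_top h) this
      exact hQ.reduced j i hji (Ideal.eq_of_le_of_height_le _ hle' (h3.trans_le h2))
    obtain ⟨g, hg, hg'⟩ := Set.not_subset.1 hle
    exact ⟨g, fun _ => ⟨hg, hg'⟩⟩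
  choose g hg using h1
  refine ⟨∏ j ∈ Finset.univ.erase i, g j, fun hmem => ?_, fun f hf => ?_⟩
  · obtain ⟨j, hj, hgj⟩ := (hp.prod_mem_iff).1 hmem
    exact (hg j (Finset.ne_of_mem_erase hj)).2 hgj
  · rw [hQ.eq_iInf, Ideal.mem_iInf]
    intro j
    by_cases hji : j = i
    · rw [hji]
      exact (Q i).mul_mem_left _ hf
    · refine (Q j).mul_mem_right _ ?_
      rw [← Finset.mul_prod_erase _ g (Finset.mem_erase.2 ⟨hji, Finset.mem_univ j⟩)]
      exact (Q j).mul_mem_right _ (hg j hji).1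

end Decomposition

/-! ### Additivity over the components of minimal height -/

section Additivity

variable {K : Type*} [Field K] {n : ℕ} {I : Ideal (MvPolynomial (Fin n) K)} {h r t : ℕ}
  {Q : Fin t → Ideal (MvPolynomial (Fin n) K)}

/-- A component of minimal height has radical generated by `h` variables, is a monomial ideal, and
is carried into `I` by a monomial in the other variables. -/
theorem exists_component_data (hI : IsMonomialIdeal I) (hh : I.height = h)
    (hQ : IsIrredundantReducedPrimaryDecomposition I Q) {i : Fin t} (hi : (Q i).height = h) :
    ∃ F : Finset (Fin n), F.card = h ∧ (Q i).radical = varIdeal K F ∧ IsMonomialIdeal (Q i) ∧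
      ∃ u : Fin n →₀ ℕ, (∀ i ∈ F, u i = 0) ∧
        Ideal.span {monomial u (1 : K)} * Q i ≤ I := by
  have hp : (Q i).radical.IsPrime := Ideal.isPrime_radical (hQ.primary i)
  obtain ⟨F, hF, hrad⟩ := exists_eq_varIdeal_of_height hI
    ((hQ.le i).trans Ideal.le_radical) hh (by rw [height_radical, hi])
  obtain ⟨g, hg, hgq⟩ := hQ.exists_not_mem_radical_mul_mem hh hi
  rw [hrad] at hg
  have hmon := isMonomialIdeal_of_isolated hI (hQ.primary i) (hQ.le i) hrad hg hgq
  exact ⟨F, hF, hrad, hmon, exists_monomial_mul_mem hI hmon hg hgq⟩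

/-- The multiplicity of the powers of a monomial ideal is the sum of those of the powers of its
primary components of minimal height. -/
theorem mult_pow_eq_sum (hI : IsMonomialIdeal I) (hh : I.height = h) (hrt : r ≤ t)
    (hQ : IsIrredundantReducedPrimaryDecomposition I Q)
    (hQ_eq : ∀ i : Fin t, (i : ℕ) < r → (Q i).height = h)
    (hQ_gt : ∀ i : Fin t, r ≤ (i : ℕ) → (h : ℕ∞) < (Q i).height) {s : ℕ} (hs : 1 ≤ s) :
    mult (I ^ s) = ∑ i : Fin r, mult (Q (Fin.castLE hrt i) ^ s) := by
  classical
  choose F hFcard hrad hmon u hu0 hu using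
    fun i : Fin r => exists_component_data hI hh hQ (hQ_eq (Fin.castLE hrt i) i.2)
  obtain ⟨M, hMI, hMQ⟩ := ((eventually_isTruncation (hI.pow s)).and
    (Filter.eventually_all.2 fun i => eventually_isTruncation ((hmon i).pow s))).exists
  -- The low set of a counted exponent recovers the radical of its component; this is what makes the
  -- union disjoint.
  have hlow : ∀ i, ∀ c ≤ cap n M, c ∉ exps (Q (Fin.castLE hrt i) ^ s) → (low M c).card = h →
      low M c = F i := by
    intro i c hc hcQ hcard
    have h1 := le_varIdeal_low ((hmon i).pow s) (hMQ i) hc hcQ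
    have h2 : varIdeal K (F i) ≤ varIdeal K (low M c) := by
      rw [← hrad i, (varIdeal_isPrime (low M c)).isRadical.radical_le_iff]
      exact (varIdeal_isPrime (low M c)).le_of_pow_le h1
    exact (Finset.eq_of_subset_of_card_le (varIdeal_le_varIdeal.1 h2)
      (by rw [hcard, hFcard])).symm
  have hunion : (Finset.Iic (cap n M)).filter
        (fun c => c ∉ exps (I ^ s) ∧ (low M c).card = h) =
      Finset.univ.biUnion fun i : Fin r => (Finset.Iic (cap n M)).filter
        (fun c => c ∉ exps (Q (Fin.castLE hrt i) ^ s) ∧ (low M c).card = h) := by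
    ext c
    simp only [Finset.mem_biUnion, Finset.mem_univ, true_and, Finset.mem_filter, Finset.mem_Iic]
    constructor
    · rintro ⟨hc, hcI, hcard⟩
      have hp := varIdeal_isPrime (K := K) (low M c)
      have h1 : I ≤ varIdeal K (low M c) := hp.le_of_pow_le (le_varIdeal_low (hI.pow s) hMI hc hcI)
      obtain ⟨j, hj⟩ := hQ.exists_le_of_le_isPrime hp h1
      -- A component of larger height cannot lie in a prime of height `h`.
      have hjr : (j : ℕ) < r := by
        by_contra hjr
        have h2 := (hQ_gt j (not_lt.1 hjr)).trans_le (Ideal.height_mono hj)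
        rw [height_varIdeal, hcard] at h2
        exact lt_irrefl _ h2
      let i : Fin r := ⟨j, hjr⟩
      have hij : Fin.castLE hrt i = j := rfl
      have hFi : F i = low M c := by
        refine Finset.eq_of_subset_of_card_le ?_ (by rw [hcard, hFcard])
        rw [← varIdeal_le_varIdeal (K := K), ← hrad i, hp.isRadical.radical_le_iff, hij]
        exact hj
      refine ⟨i, hc, fun hcQ => hcI ?_, hcard⟩
      -- If `c` were in `exps (Q_i ^ s)`, then `s • u i + c` would be in `exps (I ^ s)`; its
      -- truncation is again `c`.
      have h3 : s • u i ∈ exps (Ideal.span {monomial (u i) (1 : K)} ^ s) := by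
        have := Ideal.pow_mem_pow (Ideal.mem_span_singleton_self (monomial (u i) (1 : K))) s
        rwa [monomial_pow, one_pow] at this
      have h4 := add_mem_exps_mul h3 hcQ
      rw [← mul_pow] at h4
      have h5 := exps_mono (Ideal.pow_right_mono (hu i) s) h4
      rwa [← hMI, add_inf_cap_eq hc] at h5
      intro k hk
      rw [Finsupp.smul_apply, hu0 i k (hFi ▸ hk), smul_zero]
    · rintro ⟨i, hc, hcQ, hcard⟩
      exact ⟨hc, fun hcI => hcQ (exps_mono (Ideal.pow_right_mono (hQ.le _) s) hcI), hcard⟩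
  rw [mult_eq_card (hI.pow s) hMI (by rw [height_pow I hs, hh]), hunion, Finset.card_biUnion]
  · push_cast
    refine Finset.sum_congr rfl fun i _ => ?_
    rw [mult_eq_card ((hmon i).pow s) (hMQ i)
      (by rw [height_pow _ hs, hQ_eq (Fin.castLE hrt i) i.2])]
  · intro i _ j _ hij
    rw [Function.onFun, Finset.disjoint_left]
    intro c hci hcj
    rw [Finset.mem_filter, Finset.mem_Iic] at hci hcj
    have hFij : F i = F j := (hlow i c hci.1 hci.2.1 hci.2.2).symm.trans
      (hlow j c hcj.1 hcj.2.1 hcj.2.2)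
    refine hQ.reduced (Fin.castLE hrt i) (Fin.castLE hrt j) (fun h => hij ?_) ?_
    · exact Fin.castLE_injective hrt h
    · rw [hrad, hrad, hFij]

end Additivity

/-! ### Powers of irreducible monomial ideals -/

section Irreducible

variable {K : Type*} [Field K] {n h : ℕ}

/-- The irreducible monomial ideal generated by the powers `x_{v j} ^ a j`. -/
noncomputable def powersIdeal (K : Type*) [Field K] {n h : ℕ} (v : Fin h → Fin n)
    (a : Fin h → ℕ) : Ideal (MvPolynomial (Fin n) K) :=
  Ideal.span (Set.range fun j : Fin h => (X (v j) : MvPolynomial (Fin n) K) ^ a j)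

theorem powersIdeal_eq (v : Fin h → Fin n) (a : Fin h → ℕ) :
    powersIdeal K v a = Ideal.span ((fun m => monomial m (1 : K)) ''
      Set.range fun j => Finsupp.single (v j) (a j)) := by
  rw [powersIdeal, ← Set.range_comp]
  simp only [X_pow_eq_monomial]
  rfl

theorem isMonomialIdeal_powersIdeal (v : Fin h → Fin n) (a : Fin h → ℕ) :
    IsMonomialIdeal (powersIdeal K v a) :=
  ⟨_, powersIdeal_eq v a⟩

/-- The sum counts how many generators can be split off `m`. Multiplying by a generator raises it by
exactly one, and conversely `m` is divisible by the product of that many generators. -/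
theorem mem_exps_powersIdeal_pow {v : Fin h → Fin n} {a : Fin h → ℕ} (hv : Function.Injective v)
    (ha : ∀ j, 1 ≤ a j) {s : ℕ} {m : Fin n →₀ ℕ} :
    m ∈ exps (powersIdeal K v a ^ s) ↔ s ≤ ∑ j, m (v j) / a j := by
  constructor
  · intro hm
    have key : ∀ s, powersIdeal K v a ^ s ≤
        Ideal.span ((fun m => monomial m (1 : K)) ''
          {m : Fin n →₀ ℕ | s ≤ ∑ j, m (v j) / a j}) := by
      intro s
      induction s with
      | zero =>
        intro f _
        exact mem_ideal_span_monomial_image.2 fun m _ => ⟨m, by simp, le_rfl⟩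
      | succ s ih =>
        rw [pow_succ]
        refine (Ideal.mul_mono ih (powersIdeal_eq v a).le).trans ?_
        rw [Ideal.span_mul_span', Ideal.span_le]
        rintro _ ⟨_, ⟨m, hm, rfl⟩, _, ⟨_, ⟨j, rfl⟩, rfl⟩, rfl⟩
        refine Ideal.subset_span ⟨m + Finsupp.single (v j) (a j), ?_, ?_⟩
        · change s + 1 ≤ _
          have h1 : ∀ k, (m + Finsupp.single (v j) (a j)) (v k) / a k =
              m (v k) / a k + if k = j then 1 else 0 := by
            intro k
            rw [Finsupp.add_apply, Finsupp.single_apply]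
            by_cases hk : k = j
            · rw [hk, if_pos rfl, if_pos rfl, Nat.add_div_right _ (ha j)]
            · rw [if_neg (fun h => hk (hv h).symm), if_neg hk, add_zero, add_zero]
          simp only [h1]
          rw [Finset.sum_add_distrib, Finset.sum_ite_eq']
          simpa using hm
        · simp only [monomial_mul, one_mul]
    obtain ⟨d, hd, hdm⟩ := mem_exps_span.1 (exps_mono (key s) hm)
    exact le_trans hd (Finset.sum_le_sum fun j _ => Nat.div_le_div_right (hdm (v j)))
  · intro hm
    have h1 : ∑ j, Finsupp.single (v j) (m (v j) / a j * a j) ≤ m := by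
      intro i
      rw [Finsupp.finsetSum_apply]
      by_cases hi : ∃ j, v j = i
      · obtain ⟨j, rfl⟩ := hi
        rw [Finset.sum_eq_single j]
        · rw [Finsupp.single_eq_same]
          exact Nat.div_mul_le_self _ _
        · intro k _ hk
          exact Finsupp.single_eq_of_ne fun h => hk (hv h).symm
        · simp
      · push Not at hi
        rw [Finset.sum_eq_zero]
        · exact bot_le
        · exact fun j _ => Finsupp.single_eq_of_ne (hi j).symm
    have h2 : ∀ T : Finset (Fin h), ∑ j ∈ T, Finsupp.single (v j) (m (v j) / a j * a j) ∈
        exps (powersIdeal K v a ^ ∑ j ∈ T, m (v j) / a j) := by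
      classical
      intro T
      induction T using Finset.induction_on with
      | empty => simp [exps]
      | insert j T hj ih =>
        rw [Finset.sum_insert hj, Finset.sum_insert hj, pow_add]
        refine add_mem_exps_mul ?_ ih
        have h3 : (X (v j) : MvPolynomial (Fin n) K) ^ a j ∈ powersIdeal K v a :=
          Ideal.subset_span ⟨j, rfl⟩
        have h4 := Ideal.pow_mem_pow h3 (m (v j) / a j)
        rwa [← pow_mul, X_pow_eq_monomial, mul_comm] at h4
    exact exps_mono (Ideal.pow_le_pow_right hm) (mem_exps_of_le h1 (h2 Finset.univ))

/-- The number of exponents in `h` variables of degree less than `s`. -/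
theorem card_biUnion_finsuppAntidiag (h s : ℕ) :
    ((Finset.range (s + 1)).biUnion fun k =>
      (Finset.univ.finsuppAntidiag k : Finset (Fin h →₀ ℕ))).card = (h + s).choose s := by
  classical
  rw [Finset.card_biUnion]
  · simp only [Finset.card_finsuppAntidiag_nat_eq_choose, Finset.card_univ, Fintype.card_fin]
    induction s with
    | zero => simp
    | succ s ih =>
      -- Pascal's rule; the exponents counted have degree at most `s`.
      rw [Finset.sum_range_succ, ih, ← add_assoc, Nat.choose_succ_succ, Nat.add_sub_cancel]
  · intro i _ j _ hij
    rw [Function.onFun, Finset.disjoint_left]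
    intro c hci hcj
    rw [Finset.mem_finsuppAntidiag] at hci hcj
    exact hij (hci.1.symm.trans hcj.1)

theorem mul_add_div_eq {q r a : ℕ} (hr : r < a) : (q * a + r) / a = q := by
  rw [Nat.mul_comm, Nat.mul_add_div (by omega), Nat.div_eq_of_lt hr, add_zero]

theorem mul_add_mod_eq {q r a : ℕ} (hr : r < a) : (q * a + r) % a = r := by
  rw [Nat.mul_comm, Nat.mul_add_mod, Nat.mod_eq_of_lt hr]

/-- The multiplicity of the powers of an irreducible monomial ideal. -/
theorem mult_powersIdeal_pow {v : Fin h → Fin n} {a : Fin h → ℕ} (hv : Function.Injective v)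
    (ha : ∀ j, 1 ≤ a j) (hh : (powersIdeal K v a).height = h) {s : ℕ} (hs : 1 ≤ s) :
    mult (powersIdeal K v a ^ s) = (∏ j, (a j : ℤ)) * ((h + s - 1).choose (s - 1) : ℤ) := by
  classical
  have hmon := (isMonomialIdeal_powersIdeal (K := K) v a).pow s
  -- The bound `s * a j` keeps below the cap every entry whose quotient by `a j` is less than `s`.
  obtain ⟨M, hM, hMa⟩ := ((eventually_isTruncation hmon).and
    (Filter.eventually_all.2 fun j => Filter.eventually_ge_atTop (s * a j))).exists
  rw [mult_eq_card hmon hM (by rw [height_pow _ hs, hh])]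
  obtain ⟨s, rfl⟩ : ∃ s', s = s' + 1 := ⟨s - 1, by omega⟩
  rw [← add_assoc, Nat.add_sub_cancel, Nat.add_sub_cancel, ← card_biUnion_finsuppAntidiag h s]
  set T := (Finset.range (s + 1)).biUnion fun k =>
    (Finset.univ.finsuppAntidiag k : Finset (Fin h →₀ ℕ)) with hT
  have hmemT : ∀ q : Fin h →₀ ℕ, q ∈ T ↔ ∑ j, q j < s + 1 := by
    intro q
    simp [hT, Finset.mem_finsuppAntidiag]
  have hP : (∏ j, a j) = (Fintype.piFinset fun j => Finset.range (a j)).card := by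
    rw [Fintype.card_piFinset]
    simp
  rw [← Nat.cast_prod, hP, ← Nat.cast_mul, ← Finset.card_product]
  congr 1
  -- Inverse of division with remainder: the entries at `v j` are rebuilt from remainder and
  -- quotient, and all others sit at the cap.
  let b : (Fin h → ℕ) × (Fin h →₀ ℕ) → Fin n →₀ ℕ := fun x =>
    Finsupp.equivFunOnFinite.symm
      (Function.extend v (fun j => x.2 j * a j + x.1 j) fun _ => M)
  have hbv : ∀ x j, b x (v j) = x.2 j * a j + x.1 j := fun x j =>
    hv.extend_apply (fun j => x.2 j * a j + x.1 j) (fun _ => M) j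
  have hbn : ∀ x i, (¬ ∃ j, v j = i) → b x i = M := fun x i hi =>
    Function.extend_apply' (fun j => x.2 j * a j + x.1 j) (fun _ => M) i hi
  -- Ensures that a counted exponent equals `M` off the range of `v`, so quotients and remainders
  -- determine it.
  have hlow : ∀ c ≤ cap n M, c ∉ exps (powersIdeal K v a ^ (s + 1)) → (low M c).card = h →
      low M c = Finset.univ.image v := by
    intro c hc hcQ hcard
    have hp := varIdeal_isPrime (K := K) (low M c)
    have h1 := hp.le_of_pow_le (le_varIdeal_low hmon hM hc hcQ)
    refine (Finset.eq_of_subset_of_card_le ?_ ?_).symm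
    · intro i hi
      obtain ⟨j, -, rfl⟩ := Finset.mem_image.1 hi
      exact X_mem_varIdeal.1 (hp.mem_of_pow_mem (a j) (h1 (Ideal.subset_span ⟨j, rfl⟩)))
    · rw [hcard, Finset.card_image_of_injective _ hv, Finset.card_univ, Fintype.card_fin]
  refine Finset.card_nbij' (fun c => (fun j => c (v j) % a j,
    Finsupp.equivFunOnFinite.symm fun j => c (v j) / a j)) b ?_ ?_ ?_ ?_
  · intro c hc
    simp only [Finset.coe_filter, Finset.mem_Iic, Set.mem_ofPred_eq] at hc
    rw [mem_exps_powersIdeal_pow hv ha, not_le] at hc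
    simp only [Finset.coe_product, Set.mem_prod, Finset.mem_coe, Fintype.mem_piFinset,
      Finset.mem_range, hmemT]
    exact ⟨fun j => Nat.mod_lt _ (ha j), hc.2.1⟩
  · intro x hx
    simp only [Finset.coe_product, Set.mem_prod, Finset.mem_coe, Fintype.mem_piFinset,
      Finset.mem_range, hmemT] at hx
    have hlt : ∀ j, b x (v j) < M := by
      intro j
      have h1 : x.2 j ≤ ∑ j, x.2 j := Finset.single_le_sum (fun _ _ => bot_le) (Finset.mem_univ j)
      calc b x (v j) = x.2 j * a j + x.1 j := hbv x j
        _ < x.2 j * a j + a j := Nat.add_lt_add_left (hx.1 j) _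
        _ = (x.2 j + 1) * a j := by ring
        _ ≤ (s + 1) * a j := Nat.mul_le_mul_right _ (by omega)
        _ ≤ M := hMa j
    simp only [Finset.coe_filter, Finset.mem_Iic, Set.mem_ofPred_eq]
    refine ⟨fun i => ?_, ?_, ?_⟩
    · by_cases hi : ∃ j, v j = i
      · obtain ⟨j, rfl⟩ := hi
        exact (hlt j).le
      · exact (hbn x i hi).le
    · rw [mem_exps_powersIdeal_pow hv ha, not_le]
      simp only [hbv, mul_add_div_eq (hx.1 _)]
      exact hx.2
    · have : low M (b x) = Finset.univ.image v := by
        ext i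
        rw [mem_low, Finset.mem_image]
        constructor
        · intro hi
          by_contra hcon
          rw [hbn x i fun ⟨j, hj⟩ => hcon ⟨j, Finset.mem_univ j, hj⟩] at hi
          exact lt_irrefl _ hi
        · rintro ⟨j, -, rfl⟩
          exact hlt j
      rw [this, Finset.card_image_of_injective _ hv, Finset.card_univ, Fintype.card_fin]
  · intro c hc
    simp only [Finset.coe_filter, Finset.mem_Iic, Set.mem_ofPred_eq] at hc
    ext i
    by_cases hi : ∃ j, v j = i
    · obtain ⟨j, rfl⟩ := hi
      rw [hbv]
      exact Nat.div_add_mod' _ _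
    · rw [hbn _ i hi]
      have h1 : i ∉ low M c := by
        rw [hlow c hc.1 hc.2.1 hc.2.2, Finset.mem_image]
        rintro ⟨j, -, hj⟩
        exact hi ⟨j, hj⟩
      rw [mem_low, not_lt] at h1
      exact le_antisymm h1 (hc.1 i)
  · intro x hx
    simp only [Finset.coe_product, Set.mem_prod, Finset.mem_coe, Fintype.mem_piFinset,
      Finset.mem_range] at hx
    refine Prod.ext (funext fun j => ?_) (Finsupp.ext fun j => ?_)
    · simp only [hbv, mul_add_mod_eq (hx.1 j)]
    · simp only [Finsupp.equivFunOnFinite_symm_apply_apply, hbv, mul_add_div_eq (hx.1 j)]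

end Irreducible

end MonomialMult

/-! ### The main theorem -/

theorem theorem2p3 {K : Type*} [Field K] {n : ℕ}
    (I : Ideal (MvPolynomial (Fin n) K)) (hI : MonomialMult.IsMonomialIdeal I)
    (h : ℕ) (hh : I.height = (h : ℕ∞))
    {r t : ℕ} (hrt : r ≤ t) (Q : Fin t → Ideal (MvPolynomial (Fin n) K))
    (hQ : MonomialMult.IsIrredundantReducedPrimaryDecomposition I Q)
    (hQ_eq : ∀ i : Fin t, (i : ℕ) < r → (Q i).height = (h : ℕ∞))
    (hQ_gt : ∀ i : Fin t, r ≤ (i : ℕ) → (h : ℕ∞) < (Q i).height) :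
    (∀ s : ℕ, 1 ≤ s →
      MonomialMult.mult (I ^ s) = ∑ i : Fin r, MonomialMult.mult (Q (Fin.castLE hrt i) ^ s)) ∧
    (∀ (v : Fin r → Fin h → Fin n) (a : Fin r → Fin h → ℕ),
      (∀ i, Function.Injective (v i)) →
      (∀ i j, 1 ≤ a i j) →
      (∀ i, Q (Fin.castLE hrt i) =
        Ideal.span (Set.range fun j : Fin h =>
          (MvPolynomial.X (v i j) : MvPolynomial (Fin n) K) ^ a i j)) →
      ∀ s : ℕ, 1 ≤ s →
        MonomialMult.mult (I ^ s)
            = MonomialMult.mult I * ((h + s - 1).choose (s - 1) : ℤ) ∧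
        MonomialMult.mult I * ((h + s - 1).choose (s - 1) : ℤ)
            = ∑ i : Fin r, (∏ j : Fin h, (a i j : ℤ)) * ((h + s - 1).choose (s - 1) : ℤ)) := by
  have additive : ∀ s : ℕ, 1 ≤ s → MonomialMult.mult (I ^ s) =
      ∑ i : Fin r, MonomialMult.mult (Q (Fin.castLE hrt i) ^ s) := fun s hs =>
    MonomialMult.mult_pow_eq_sum hI hh hrt hQ hQ_eq hQ_gt hs
  refine ⟨additive, fun v a hv ha hQva s hs => ?_⟩
  have formula : ∀ s : ℕ, 1 ≤ s → MonomialMult.mult (I ^ s) =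
      ∑ i : Fin r, (∏ j : Fin h, (a i j : ℤ)) * ((h + s - 1).choose (s - 1) : ℤ) := by
    intro s hs
    rw [additive s hs]
    refine Finset.sum_congr rfl fun i _ => ?_
    have hheight := hQ_eq (Fin.castLE hrt i) i.2
    rw [hQva i] at hheight ⊢
    exact MonomialMult.mult_powersIdeal_pow (hv i) (ha i) hheight hs
  -- At `s = 1` the binomial coefficient is `choose h 0 = 1`.
  have hmult : MonomialMult.mult I = ∑ i : Fin r, ∏ j : Fin h, (a i j : ℤ) := by
    simpa using formula 1 le_rfl
  rw [formula s hs, hmult, Finset.sum_mul]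
  exact ⟨rfl, rfl⟩
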